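/- Let $X$ and $U$ be complex Banach spaces, let $A$ be the infinitesimal generator of a strongly continuous semigroup $\{S(t)\}_{t\ge 0}$ on $X$, let $\sigma$ be the spectrum of $A$, let $\mu\notin\sigma$ and $R_\mu=(\mu I-A)^{-1}$. Let $V$ be the completion of $X$ with respect to the norm $\|R_\mu x\|$; denote by the same letter $R_\mu:V\to X$ the continuous extension of $R_\mu$ to $V$, and by $\mathcal S(t):V\to V$ the continuous extension of $S(t)$. Let $B:U\to V$ be a bounded linear operator such that for each $t\ge 0$ the formula $\Phi(t)u=\int_0^t\mathcal S(t-\tau)Bu(\tau)\,d\tau$ (integral in $V$) defines a bounded operator from $L_2([0,t],U)$ to $X$. Consider the equation $$\dot x(t)=Ax(t)+Bu(t),\qquad x(0)=x_0,\tag{1}$$ whose weak solution for a control $u\in L_2([0,t_1],U)$ is $x(t,x_0,u)=S(t)x_0+\int_0^t\mathcal S(t-\tau)Bu(\tau)\,d\tau$. Equation (1) is called approximately null-controllable on $[0,t_1]$ if for all $x_0\in X$ and $\varepsilon>0$ there is $u\in L_2([0,t_1],U)$ with $\|x(t_1,x_0,u)\|<\varepsilon$. Assume: (I) the domain $D(A^*)$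 of the adjoint of $A$ is dense in $X^*$; (II) every point of $\sigma$ is an eigenvalue of $A$ of finite multiplicity, and $\sigma$ is finite or has no finite limit points; (III) there is $T\ge 0$ such that for all $v\in V$ and $t>T$ the function $\mathcal S(t)v$ is expanded in a series of generalized eigenvectors of $A$ which, for a certain grouping of terms, converges in the norm of $V$, uniformly in $t$ on every interval $[T_1,T_2]$ with $T_1>T$; (minimality) for a number $\nu>0$ the family of functions $f_{\lambda k}(t)=(-t)^k e^{-\lambda t}$, $\lambda\in\sigma$, $k=0,\dots,\alpha_\lambda-1$, where $\alpha_\lambda$ is the dimension of the generalized eigenspace of $A$ at $\lambda$, is minimal on $[0,\nu]$, that is, there are functions $y_{\lambda k}\in L_2[0,\nu]$ with $\int_0^\nu f_{\lambda k}(t)y_{\lambda' k'}(t)\,dt=\delta_{\lambda\lambda'}\delta_{kk'}$. Let $t_1\ge 0$ and put $$\mathrm{Range}\{\lambda I-A,R_\mu B\}=\{(\lambda I-A)x+R_\mu Bu:\ x\in D(A),\ u\in U\}.$$ For equation (1) to be approximately null-controllable on $[0,t_1]$ it is necessary, and, if $t_1>T+\nu$, also sufficient, that $$\overline{\mathrm{Range}\{\lambda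 I-A,R_\mu B\}}=X\qquad\text{for all }\lambda\in\sigma.$$ -/

import Mathlib

open Filter Topology MeasureTheory

open scoped ENNReal

/-- A strongly continuous (class `C₀`) one-parameter semigroup `S(t)`, `t ≥ 0`, of bounded linear
operators on a complex normed space.  Values at negative times are irrelevant. -/
structure C0Semigroup (X : Type*) [NormedAddCommGroup X] [NormedSpace ℂ X] where
  /-- the operators of the semigroup -/
  op : ℝ → X →L[ℂ] X
  op_zero : op 0 = ContinuousLinearMap.id ℂ X
  op_add : ∀ s t : ℝ, 0 ≤ s → 0 ≤ t → op (s + t) = (op s).comp (op t)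
  tendsto_zero : ∀ x : X, Tendsto (fun t : ℝ => op t x) (𝓝[>] 0) (𝓝 x)

namespace C0Semigroup

section Generator

variable {X : Type*} [NormedAddCommGroup X] [NormedSpace ℂ X]

/-- The domain of the infinitesimal generator: all `x` for which `t⁻¹ (S(t) x - x)` has a limit
as `t → 0+`. -/
def generatorDomain (S : C0Semigroup X) : Submodule ℂ X where
  carrier := {x | ∃ y : X, Tendsto (fun t : ℝ => ((t : ℂ)⁻¹) • (S.op t x - x)) (𝓝[>] 0) (𝓝 y)}
  zero_mem' := ⟨0, by simp⟩
  add_mem' := by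
    rintro a b ⟨y, hy⟩ ⟨z, hz⟩
    refine ⟨y + z, (hy.add hz).congr fun t => ?_⟩
    rw [← smul_add, map_add]
    congr 1
    abel
  smul_mem' := by
    rintro c a ⟨y, hy⟩
    refine ⟨c • y, (hy.const_smul c).congr fun t => ?_⟩
    rw [smul_comm, map_smul, smul_sub]

/-- The limit defining the generator at a point of its domain. -/
noncomputable def generatorFun (S : C0Semigroup X) (x : S.generatorDomain) : X :=
  Classical.choose x.2

theorem generatorFun_spec (S : C0Semigroup X) (x : S.generatorDomain) :
    Tendsto (fun t : ℝ => ((t : ℂ)⁻¹) • (S.op t (x : X) - x)) (𝓝[>] 0) (𝓝 (S.generatorFun x)) :=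
  Classical.choose_spec x.2

/-- The infinitesimal generator `A` of the semigroup, `A x = lim_{t → 0+} t⁻¹ (S(t) x - x)`. -/
noncomputable def generator (S : C0Semigroup X) : X →ₗ.[ℂ] X where
  domain := S.generatorDomain
  toFun :=
    { toFun := S.generatorFun
      map_add' := by
        intro a b
        refine tendsto_nhds_unique (S.generatorFun_spec (a + b))
          (((S.generatorFun_spec a).add (S.generatorFun_spec b)).congr fun t => ?_)
        rw [← smul_add, Submodule.coe_add, map_add]
        congr 1
        abel
      map_smul' := by
        intro c a
        refine tendsto_nhds_unique (S.generatorFun_spec (c • a))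
          (((S.generatorFun_spec a).const_smul c).congr fun t => ?_)
        rw [smul_comm, Submodule.coe_smul, map_smul, smul_sub] }

theorem generator_spec (S : C0Semigroup X) (x : S.generator.domain) :
    Tendsto (fun t : ℝ => ((t : ℂ)⁻¹) • (S.op t (x : X) - x)) (𝓝[>] 0) (𝓝 (S.generator x)) :=
  S.generatorFun_spec x

/-- `R` is a bounded two-sided inverse of `μ I - A : D(A) → X`. -/
def IsResolvent (S : C0Semigroup X) (μ : ℂ) (R : X →L[ℂ] X) : Prop :=
  (∀ y : X, ∃ h : R y ∈ S.generator.domain, μ • R y - S.generator ⟨R y, h⟩ = y) ∧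
    ∀ x : S.generator.domain, R (μ • (x : X) - S.generator x) = x

/-- The spectrum `σ` of the generator: the set of those `μ` for which `μ I - A : D(A) → X` has no
bounded inverse. -/
def spectrum (S : C0Semigroup X) : Set ℂ :=
  {μ | ¬ ∃ R : X →L[ℂ] X, S.IsResolvent μ R}

/-- The resolvent `R_μ = (μ I - A)⁻¹` at a point `μ ∉ σ`. -/
noncomputable def resolvent (S : C0Semigroup X) {μ : ℂ} (hμ : μ ∉ S.spectrum) : X →L[ℂ] X :=
  Classical.choose (not_not.mp hμ)

theorem resolvent_spec (S : C0Semigroup X) {μ : ℂ} (hμ : μ ∉ S.spectrum) :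
    S.IsResolvent μ (S.resolvent hμ) :=
  Classical.choose_spec (not_not.mp hμ)

theorem resolvent_injective (S : C0Semigroup X) {μ : ℂ} (hμ : μ ∉ S.spectrum) :
    Function.Injective (S.resolvent hμ) := by
  intro x y hxy
  obtain ⟨h1, e1⟩ := (S.resolvent_spec hμ).1 x
  obtain ⟨h2, e2⟩ := (S.resolvent_spec hμ).1 y
  have h3 : (⟨S.resolvent hμ x, h1⟩ : S.generator.domain) = ⟨S.resolvent hμ y, h2⟩ :=
    Subtype.ext hxy
  rw [← e1, ← e2, h3, hxy]

/-- The semigroup leaves `D(A)` invariant and commutes with `A` there. -/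
theorem generator_op (S : C0Semigroup X) {t : ℝ} (ht : 0 ≤ t) (x : S.generator.domain) :
    ∃ h : S.op t (x : X) ∈ S.generator.domain,
      S.generator ⟨S.op t (x : X), h⟩ = S.op t (S.generator x) := by
  have key : Tendsto (fun s : ℝ => ((s : ℂ)⁻¹) • (S.op s (S.op t (x : X)) - S.op t (x : X)))
      (𝓝[>] 0) (𝓝 (S.op t (S.generator x))) := by
    refine Tendsto.congr' ?_ (((S.op t).continuous.tendsto _).comp (S.generator_spec x))
    filter_upwards [self_mem_nhdsWithin] with s hs
    have hs' : (0 : ℝ) ≤ s := le_of_lt hs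
    have e : S.op s (S.op t (x : X)) = S.op t (S.op s (x : X)) := by
      rw [← ContinuousLinearMap.comp_apply, ← ContinuousLinearMap.comp_apply,
        ← S.op_add s t hs' ht, ← S.op_add t s ht hs', add_comm]
    simp only [Function.comp_apply, map_smul, map_sub, e]
  exact ⟨⟨_, key⟩, tendsto_nhds_unique (S.generator_spec ⟨S.op t (x : X), ⟨_, key⟩⟩) key⟩

theorem resolvent_op (S : C0Semigroup X) {μ : ℂ} (hμ : μ ∉ S.spectrum) {t : ℝ} (ht : 0 ≤ t)
    (x : X) : S.resolvent hμ (S.op t x) = S.op t (S.resolvent hμ x) := by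
  obtain ⟨h1, e1⟩ := (S.resolvent_spec hμ).1 x
  obtain ⟨h2, e2⟩ := S.generator_op ht ⟨S.resolvent hμ x, h1⟩
  have := (S.resolvent_spec hμ).2 ⟨S.op t (S.resolvent hμ x), h2⟩
  rw [e2] at this
  refine Eq.trans ?_ this
  congr 1
  conv_lhs => rw [← e1]
  simp only [map_sub, map_smul]

/-- The kernel of `(A - λ I)ⁿ`, on its natural domain. -/
noncomputable def genKer (S : C0Semigroup X) (l : ℂ) : ℕ → Submodule ℂ X
  | 0 => ⊥
  | n + 1 => Submodule.map S.generator.domain.subtype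
      (Submodule.comap (S.generator.toFun - l • S.generator.domain.subtype) (genKer S l n))

/-- The generalized eigenspace `⋃ₙ ker (A - λ I)ⁿ` of `A` at `λ`: the generalized eigenvectors of
`A` at `λ`, together with zero. -/
noncomputable def genEigenspace (S : C0Semigroup X) (l : ℂ) : Submodule ℂ X :=
  ⨆ n, S.genKer l n

/-- The (algebraic) multiplicity of `λ`: the dimension of the generalized eigenspace. -/
noncomputable def multiplicity (S : C0Semigroup X) (l : ℂ) : ℕ :=
  Module.finrank ℂ (S.genEigenspace l)

/-- The domain `D(A*)` of the Banach space adjoint of the generator. -/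
def adjointDomain (S : C0Semigroup X) : Set (StrongDual ℂ X) :=
  {f | ∃ g : StrongDual ℂ X, ∀ x : S.generator.domain, f (S.generator x) = g (x : X)}

/-- Property (I): `D(A*)` is dense in `X*`. -/
def PropertyI (S : C0Semigroup X) : Prop :=
  Dense S.adjointDomain

/-- Property (II): the spectrum consists of eigenvalues of finite multiplicity and has no finite
limit points. -/
def PropertyII (S : C0Semigroup X) : Prop :=
  (∀ l ∈ S.spectrum, ∃ x : S.generator.domain, (x : X) ≠ 0 ∧ S.generator x = l • (x : X)) ∧
    (∀ l ∈ S.spectrum, Module.Finite ℂ (S.genEigenspace l)) ∧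
    ∀ z : ℂ, ¬ AccPt z (𝓟 S.spectrum)

/-- The functions `t ↦ (-t)ᵏ exp (-λ t)`, indexed by the pairs `(λ, k)` with `λ ∈ σ` and
`0 ≤ k < α`, where `α` is the multiplicity of `λ`. -/
noncomputable def expFamily (S : C0Semigroup X) :
    (Σ l : S.spectrum, Fin (S.multiplicity l)) → ℝ → ℂ :=
  fun p t => (-(t : ℂ)) ^ (p.2 : ℕ) * Complex.exp (-(p.1 : ℂ) * t)

end Generator

/-- A family of functions is minimal on `[0, ν]` if it has a biorthogonal family in
`L²[0, ν]`. -/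
def IsMinimalOn {ι : Type*} (f : ι → ℝ → ℂ) (ν : ℝ) : Prop :=
  ∃ y : ι → ℝ → ℂ, (∀ j, MemLp (y j) 2 (volume.restrict (Set.Icc 0 ν))) ∧
    (∀ i, ∫ t in Set.Icc 0 ν, f i t * y i t = 1) ∧
    ∀ i j, i ≠ j → ∫ t in Set.Icc 0 ν, f i t * y j t = 0

section Extrapolation

variable {X : Type*} [NormedAddCommGroup X] [NormedSpace ℂ X]

/-- The vector space `X`, to be given the norm `‖R_μ x‖`. -/
def Core (_S : C0Semigroup X) {μ : ℂ} (_hμ : μ ∉ _S.spectrum) : Type _ := X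

variable (S : C0Semigroup X) {μ : ℂ} (hμ : μ ∉ S.spectrum)

instance : AddCommGroup (S.Core hμ) := inferInstanceAs (AddCommGroup X)

instance : Module ℂ (S.Core hμ) := inferInstanceAs (Module ℂ X)

/-- The resolvent as a linear map on the renormed space. -/
noncomputable def coreResolvent : S.Core hμ →ₗ[ℂ] X := (S.resolvent hμ : X →ₗ[ℂ] X)

/-- The norm `‖R_μ x‖`. -/
noncomputable instance : NormedAddCommGroup (S.Core hμ) :=
  NormedAddCommGroup.induced (S.Core hμ) X (S.coreResolvent hμ) (S.resolvent_injective hμ)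

noncomputable instance : NormedSpace ℂ (S.Core hμ) :=
  NormedSpace.induced ℂ (S.Core hμ) X (S.coreResolvent hμ)

/-- The space `V`: the completion of `X` with respect to the norm `‖R_μ x‖`. -/
abbrev Extrap : Type _ := UniformSpace.Completion (S.Core hμ)

/-- The embedding `X ⊂ V`. -/
noncomputable def embed : X →ₗ[ℂ] S.Extrap hμ where
  toFun x := ((show S.Core hμ from x : S.Core hμ) : UniformSpace.Completion (S.Core hμ))
  map_add' x y := UniformSpace.Completion.coe_add (α := S.Core hμ) x y
  map_smul' c x := UniformSpace.Completion.coe_smul (X := S.Core hμ) c x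

theorem norm_embed (x : X) : ‖S.embed hμ x‖ = ‖S.resolvent hμ x‖ :=
  UniformSpace.Completion.norm_coe (E := S.Core hμ) x

theorem denseRange_embed : DenseRange (S.embed hμ) :=
  UniformSpace.Completion.denseRange_coe (α := S.Core hμ)

/-- The continuous extension `R_μ : V → X` of the resolvent. -/
noncomputable def extResolvent [CompleteSpace X] : S.Extrap hμ →L[ℂ] X :=
  (S.resolvent hμ : X →ₗ[ℂ] X).extendOfNorm (S.embed hμ)

theorem extResolvent_embed [CompleteSpace X] (x : X) :
    S.extResolvent hμ (S.embed hμ x) = S.resolvent hμ x :=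
  LinearMap.extendOfNorm_eq (S.denseRange_embed hμ)
    ⟨1, fun y => by rw [norm_embed, one_mul]; exact le_rfl⟩ x

/-- The continuous extension of `S(t)` to `V`, for `t ≥ 0`. -/
noncomputable def extOp (t : ℝ) : S.Extrap hμ →L[ℂ] S.Extrap hμ :=
  ((S.embed hμ).comp (S.op t : X →ₗ[ℂ] X)).extendOfNorm (S.embed hμ)

theorem extOp_embed {t : ℝ} (ht : 0 ≤ t) (x : X) :
    S.extOp hμ t (S.embed hμ x) = S.embed hμ (S.op t x) :=
  LinearMap.extendOfNorm_eq (S.denseRange_embed hμ)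
    ⟨‖S.op t‖, fun y => by
      change ‖S.embed hμ (S.op t y)‖ ≤ _
      rw [norm_embed, norm_embed, S.resolvent_op hμ ht]
      exact (S.op t).le_opNorm _⟩ x

/-- Property (III) for the time `T`: for each `v ∈ V` the function `t ↦ S(t) v`, `t > T`, is
expanded in a series of generalized eigenvectors of `A` which, for a suitable grouping of its
terms, converges in the norm of `V`, uniformly on `[T₁, T₂]` whenever `T₁ > T`.  Here `F m` is
the set of eigenvalues that occur in the first `m` groups, and `c l t` is the component of the
expansion in the generalized eigenspace at `l`. -/
def PropertyIII (T : ℝ) : Prop :=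
  ∀ v : S.Extrap hμ, ∃ (F : ℕ → Finset ℂ) (c : ℂ → ℝ → X),
    Monotone F ∧ (∀ m, (F m : Set ℂ) ⊆ S.spectrum) ∧ (∀ l ∈ S.spectrum, ∃ m, l ∈ F m) ∧
    (∀ l ∈ S.spectrum, ∀ t, T < t → c l t ∈ S.genEigenspace l) ∧
    ∀ T₁ T₂ : ℝ, T < T₁ →
      TendstoUniformlyOn (fun (m : ℕ) (t : ℝ) => ∑ l ∈ F m, S.embed hμ (c l t))
        (fun t => S.extOp hμ t v) atTop (Set.Icc T₁ T₂)

variable {U : Type*} [NormedAddCommGroup U] [NormedSpace ℂ U]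

/-- The integral `∫₀ᵗ S(t - τ) B u(τ) dτ`, taken in `V`. -/
noncomputable def inputIntegral (B : U →L[ℂ] S.Extrap hμ) (t : ℝ)
    (u : Lp U 2 (volume.restrict (Set.Icc 0 t))) : S.Extrap hμ :=
  ∫ τ in Set.Icc 0 t, S.extOp hμ (t - τ) (B (u τ))

/-- Admissibility of the input operator: for each `t ≥ 0`, the formula
`Φ(t) u = ∫₀ᵗ S(t - τ) B u(τ) dτ` defines a bounded operator from `L²([0, t], U)` to `X`. -/
def Admissible (B : U →L[ℂ] S.Extrap hμ) : Prop :=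
  ∀ t : ℝ, 0 ≤ t → ∃ Φ : Lp U 2 (volume.restrict (Set.Icc (0 : ℝ) t)) →L[ℂ] X,
    ∀ u, S.embed hμ (Φ u) = S.inputIntegral hμ B t u

/-- `x ∈ X` is the value at time `t` of the weak solution of `x' = A x + B u`, `x(0) = x₀`, that is
`x = S(t) x₀ + ∫₀ᵗ S(t - τ) B u(τ) dτ`. -/
def IsWeakSolutionAt (B : U →L[ℂ] S.Extrap hμ) (x₀ : X) (t : ℝ)
    (u : Lp U 2 (volume.restrict (Set.Icc 0 t))) (x : X) : Prop :=
  S.embed hμ x = S.embed hμ (S.op t x₀) + S.inputIntegral hμ B t u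

/-- Approximate null-controllability on `[0, t₁]`: every initial state can be steered at time `t₁`
into every neighbourhood of the origin. -/
def ApproxNullControllable (B : U →L[ℂ] S.Extrap hμ) (t₁ : ℝ) : Prop :=
  ∀ x₀ : X, ∀ ε : ℝ, 0 < ε → ∃ (u : Lp U 2 (volume.restrict (Set.Icc (0 : ℝ) t₁))) (x : X),
    S.IsWeakSolutionAt hμ B x₀ t₁ u x ∧ ‖x‖ < ε

/-- The set `Range {λ I - A, R_μ B}` of all `(λ I - A) x + R_μ B u`, `x ∈ D(A)`, `u ∈ U`. -/
def controlRange [CompleteSpace X] (B : U →L[ℂ] S.Extrap hμ) (l : ℂ) : Set X :=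
  {z | ∃ (x : S.generator.domain) (u : U),
    z = (l • (x : X) - S.generator x) + S.extResolvent hμ (B u)}

end Extrapolation

end C0Semigroup

/-! Write E_λ for the generalized eigenspace at λ and N for A - λ on E_λ. Both directions are
duality arguments.

Necessity (`ApproxNullControllable.closure_controlRange`): a functional g killing `controlRange` at
λ satisfies g(S(s)x) = exp(λs) g(x), and G = g ∘ R_μ is an eigenfunctional on V with G ∘ B = 0.
Controls are therefore invisible to G: every state reached at time t from z has G-value exp(λt)
G(z). Since these states can be made arbitrarily small, G(z) = 0, and then g(z) = 0.

Sufficiency (`approxNullControllable_of_closure_controlRange`): let g vanish on the range of Φ(t);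
it must be shown that g(S(t)x₀) = 0. As g lives on X while the expansions converge only in V, g is
replaced by G = g ∘ J, where J = ∫₀ᵈ S(r) dr maps V to X (`exists_intOp_extension`). Piecewise
constant controls give G(S(r)Bu) = 0 for r in [s, s + ν], s = t - d - ν, and s > T for small d. On
E_λ, S(ν - τ)x is a combination of (-τ)ᵏ exp(-λτ) with coefficients S(ν)Nᵏx/k!. Integrating G(S(ν -
τ)w) against a biorthogonal function gives a functional M on V that isolates one λ and one power k =
j. If j is the last power with G ∘ S(ν) ∘ Nʲ ≠ 0 on E_λ, then M is an eigenfunctional on E_λ. The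
expansion of S(s)v makes M ∘ S(s) one on all of V, and it kills B, so the range condition forces it
to vanish (`eigenfunctional_eq_zero`), a contradiction. Hence G ∘ S(ν) kills all generalized
eigenvectors and, by expansion, G(S(ν + s)x₀) = 0. Dividing by d and letting d → 0 gives g(S(t)x₀) =
0. -/

/-- A vector outside the closure of a subspace is detected by a functional vanishing on it. -/
theorem Submodule.exists_dual_of_notMem_closure {E : Type*} [NormedAddCommGroup E]
    [NormedSpace ℂ E] (p : Submodule ℂ E) {x : E} (hx : x ∉ closure (p : Set E)) :
    ∃ g : StrongDual ℂ E, (∀ y ∈ p, g y = 0) ∧ g x ≠ 0 := by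
  have hc : IsClosed (p.topologicalClosure : Set E) := p.isClosed_topologicalClosure
  have hx' : p.topologicalClosure.mkQL x ≠ 0 := by
    intro h
    exact hx ((Submodule.Quotient.mk_eq_zero _).1 h)
  have : IsClosed (p.topologicalClosure : Set E) := hc
  obtain ⟨f, hf⟩ := SeparatingDual.exists_ne_zero (R := ℂ) hx'
  refine ⟨f.comp p.topologicalClosure.mkQL, fun y hy => ?_, hf⟩
  have : p.topologicalClosure.mkQL y = 0 :=
    (Submodule.Quotient.mk_eq_zero _).2 (p.le_topologicalClosure hy)
  simp [this]

/-! ### Strongly continuous semigroups: local bounds, continuity, integrated orbits. -/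

namespace C0Semigroup

section Basic

variable {X : Type*} [NormedAddCommGroup X] [NormedSpace ℂ X] (S : C0Semigroup X)

theorem op_add_apply {s t : ℝ} (hs : 0 ≤ s) (ht : 0 ≤ t) (x : X) :
    S.op (s + t) x = S.op s (S.op t x) := by
  rw [S.op_add s t hs ht, ContinuousLinearMap.comp_apply]

theorem op_comm {s t : ℝ} (hs : 0 ≤ s) (ht : 0 ≤ t) (x : X) :
    S.op s (S.op t x) = S.op t (S.op s x) := by
  rw [← S.op_add_apply hs ht, ← S.op_add_apply ht hs, add_comm]

theorem tendsto_op_nhdsGE_zero (x : X) :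
    Tendsto (fun t : ℝ => S.op t x) (𝓝[≥] 0) (𝓝 x) := by
  rw [← Set.Ioi_insert, nhdsWithin_insert, tendsto_sup]
  refine ⟨?_, S.tendsto_zero x⟩
  simpa [S.op_zero] using tendsto_pure_nhds (fun t : ℝ => S.op t x) 0

/-- The right derivative suffices below: a continuous function with zero right derivative is
constant. -/
theorem hasDerivWithinAt_op (x : S.generator.domain) {t : ℝ} (ht : 0 ≤ t) :
    HasDerivWithinAt (fun s : ℝ => S.op s (x : X)) (S.op t (S.generator x)) (Set.Ici t) t := by
  rw [← hasDerivWithinAt_Ioi_iff_Ici, hasDerivWithinAt_iff_tendsto_slope' (by simp)]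
  have h1 : Tendsto (fun s : ℝ => s - t) (𝓝[>] t) (𝓝[>] 0) := by
    refine tendsto_nhdsWithin_iff.2 ⟨?_, ?_⟩
    · have : Continuous fun s : ℝ => s - t := by fun_prop
      simpa using (this.tendsto t).mono_left nhdsWithin_le_nhds
    · filter_upwards [self_mem_nhdsWithin] with s hs
      exact Set.mem_Ioi.2 (sub_pos.2 (Set.mem_Ioi.1 hs))
  refine Tendsto.congr' ?_
    (((S.op t).continuous.tendsto _).comp ((S.generator_spec x).comp h1))
  filter_upwards [self_mem_nhdsWithin] with s hs
  have hs' : t < s := hs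
  have e : S.op s (x : X) = S.op t (S.op (s - t) x) := by
    rw [← S.op_add_apply ht (by linarith)]
    congr 2
    ring
  simp only [Function.comp_apply, slope, vsub_eq_sub, map_smul, map_sub, e]
  rw [← Complex.ofReal_inv, Complex.coe_smul]

/-- The integral `∫₀ᵈ S(r) x dr`. -/
noncomputable def intOp (d : ℝ) (x : X) : X := ∫ r in (0 : ℝ)..d, S.op r x

variable [CompleteSpace X]

theorem exists_norm_op_le_near_zero :
    ∃ δ : ℝ, 0 < δ ∧ ∃ C : ℝ, ∀ t ∈ Set.Icc 0 δ, ‖S.op t‖ ≤ C := by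
  by_contra! H
  have H' : ∀ n : ℕ, ∃ t ∈ Set.Icc (0 : ℝ) (1 / ((n : ℝ) + 1)), (n : ℝ) < ‖S.op t‖ := fun n =>
    H _ (by positivity) n
  choose t ht hn using H'
  have ht0 : Tendsto t atTop (𝓝[≥] 0) := by
    refine tendsto_nhdsWithin_iff.2 ⟨?_, Eventually.of_forall fun n => (ht n).1⟩
    exact squeeze_zero (fun n => (ht n).1) (fun n => (ht n).2)
      tendsto_one_div_add_atTop_nhds_zero_nat
  -- Orbits converge along t n → 0, hence are bounded there; uniform boundedness contradicts ‖S(t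
  -- n)‖ > n.
  obtain ⟨C, hC⟩ := banach_steinhaus (g := fun n => S.op (t n)) fun x => by
    have h := ((S.tendsto_op_nhdsGE_zero x).comp ht0).norm
    obtain ⟨C, hC⟩ := h.bddAbove_range
    exact ⟨C, fun n => hC ⟨n, rfl⟩⟩
  obtain ⟨n, hn'⟩ := exists_nat_gt C
  exact absurd (hC n) (not_le.2 (hn'.trans (hn n)))

/-- A strongly continuous semigroup is bounded on bounded intervals. -/
theorem exists_norm_op_le (b : ℝ) : ∃ C : ℝ, 0 ≤ C ∧ ∀ t ∈ Set.Icc 0 b, ‖S.op t‖ ≤ C := by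
  obtain ⟨δ, hδ, C, hC⟩ := S.exists_norm_op_le_near_zero
  have hC0 : 0 ≤ C := (norm_nonneg _).trans (hC 0 ⟨le_rfl, hδ.le⟩)
  have key : ∀ n : ℕ, ∃ D : ℝ, 0 ≤ D ∧ ∀ t ∈ Set.Icc 0 (n * δ), ‖S.op t‖ ≤ D := by
    intro n
    induction n with
    | zero =>
      refine ⟨C, hC0, fun t ht => hC t ⟨ht.1, ?_⟩⟩
      have := ht.2
      simp only [Nat.cast_zero, zero_mul] at this
      linarith
    | succ n ih =>
      obtain ⟨D, hD0, hD⟩ := ih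
      refine ⟨max C (C * D), le_max_of_le_left hC0, fun t ht => ?_⟩
      rcases le_total t δ with h | h
      · exact le_max_of_le_left (hC t ⟨ht.1, h⟩)
      · refine le_max_of_le_right ?_
        have e : t = δ + (t - δ) := by ring
        rw [e, S.op_add δ (t - δ) hδ.le (by linarith)]
        refine (ContinuousLinearMap.opNorm_comp_le _ _).trans ?_
        refine mul_le_mul (hC δ ⟨hδ.le, le_rfl⟩) (hD _ ⟨by linarith, ?_⟩) (norm_nonneg _) hC0
        have := ht.2
        push_cast at this
        linarith
  obtain ⟨n, hn⟩ := exists_nat_gt (b / δ)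
  obtain ⟨D, hD0, hD⟩ := key n
  refine ⟨D, hD0, fun t ht => hD t ⟨ht.1, ht.2.trans ?_⟩⟩
  rw [div_lt_iff₀ hδ] at hn
  exact hn.le

theorem continuousOn_op (x : X) : ContinuousOn (fun t : ℝ => S.op t x) (Set.Ici 0) := by
  intro t ht
  obtain ⟨C, hC0, hC⟩ := S.exists_norm_op_le (t + 1)
  -- Factoring out the earlier time reduces left and right continuity alike to continuity at 0.
  have key : ∀ a ∈ Set.Icc (0 : ℝ) (t + 1), ∀ b, a ≤ b →
      ‖S.op b x - S.op a x‖ ≤ C * ‖S.op (b - a) x - x‖ := by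
    intro a ha b hab
    have e : S.op b x = S.op a (S.op (b - a) x) := by
      rw [← S.op_add_apply ha.1 (by linarith)]
      congr 2
      ring
    rw [e, ← map_sub]
    exact (ContinuousLinearMap.le_opNorm _ _).trans
      (mul_le_mul_of_nonneg_right (hC a ha) (norm_nonneg _))
  have hlim : Tendsto (fun s : ℝ => C * ‖S.op |s - t| x - x‖) (𝓝[Set.Ici 0] t) (𝓝 0) := by
    have h1 : Tendsto (fun s : ℝ => |s - t|) (𝓝[Set.Ici 0] t) (𝓝[≥] 0) := by
      refine tendsto_nhdsWithin_iff.2 ⟨?_, Eventually.of_forall fun s => abs_nonneg (s - t)⟩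
      have : Continuous fun s : ℝ => |s - t| := by fun_prop
      simpa using (this.tendsto t).mono_left nhdsWithin_le_nhds
    have h2 := ((S.tendsto_op_nhdsGE_zero x).comp h1).sub_const x
    simpa using h2.norm.const_mul C
  refine tendsto_iff_norm_sub_tendsto_zero.2 (squeeze_zero' (Eventually.of_forall fun _ =>
    norm_nonneg _) ?_ hlim)
  have hev : ∀ᶠ s in 𝓝[Set.Ici 0] t, s < t + 1 :=
    mem_nhdsWithin_of_mem_nhds (Iio_mem_nhds (by linarith))
  filter_upwards [self_mem_nhdsWithin, hev] with s hs hs'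
  rcases le_total s t with h | h
  · rw [norm_sub_rev, abs_of_nonpos (by linarith), neg_sub]
    exact key s ⟨hs, hs'.le⟩ t h
  · rw [abs_of_nonneg (by linarith)]
    exact key t ⟨ht, by linarith⟩ s h

/-- Values at negative times are arbitrary; clamping makes the integrand continuous on the whole
line, so its primitive has a two-sided derivative even at 0. -/
theorem continuous_op_max (x : X) : Continuous fun r : ℝ => S.op (max r 0) x :=
  (S.continuousOn_op x).comp_continuous (by fun_prop) fun r => le_max_right r 0

theorem intervalIntegrable_op (x : X) {a b : ℝ} (ha : 0 ≤ a) (hb : 0 ≤ b) :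
    IntervalIntegrable (fun r : ℝ => S.op r x) volume a b := by
  refine ContinuousOn.intervalIntegrable ((S.continuousOn_op x).mono ?_)
  exact fun r hr => (le_min ha hb).trans hr.1

theorem op_intOp {d h : ℝ} (hd : 0 ≤ d) (hh : 0 ≤ h) (x : X) :
    S.op h (S.intOp d x) = ∫ r in h..(d + h), S.op r x := by
  rw [intOp, ← ContinuousLinearMap.intervalIntegral_comp_comm _ (S.intervalIntegrable_op x le_rfl hd)]
  have : (∫ r in (0 : ℝ)..d, S.op h (S.op r x)) = ∫ r in (0 : ℝ)..d, S.op (r + h) x := by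
    refine intervalIntegral.integral_congr fun r hr => ?_
    rw [Set.uIcc_of_le hd] at hr
    rw [add_comm, S.op_add_apply hh hr.1]
  rw [this, intervalIntegral.integral_comp_add_right (fun r => S.op r x)]
  simp

/-- The primitive `t ↦ ∫₀ᵗ S(r) x dr`, extended linearly to negative times. -/
noncomputable def primitive (x : X) (t : ℝ) : X := ∫ r in (0 : ℝ)..t, S.op (max r 0) x

theorem hasDerivAt_primitive (x : X) {t : ℝ} (ht : 0 ≤ t) :
    HasDerivAt (S.primitive x) (S.op t x) t := by
  have := ((S.continuous_op_max x).integral_hasStrictDerivAt 0 t).hasDerivAt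
  rwa [max_eq_left ht] at this

theorem integral_op_eq_sub (x : X) {a b : ℝ} (ha : 0 ≤ a) (hb : 0 ≤ b) :
    (∫ r in a..b, S.op r x) = S.primitive x b - S.primitive x a := by
  rw [primitive, primitive, intervalIntegral.integral_interval_sub_left
    ((S.continuous_op_max x).intervalIntegrable _ _)
    ((S.continuous_op_max x).intervalIntegrable _ _)]
  refine intervalIntegral.integral_congr fun r hr => ?_
  have : 0 ≤ r := (le_min ha hb).trans hr.1
  simp [max_eq_left this]

theorem tendsto_average_op (x : X) {t : ℝ} (ht : 0 < t) :
    Tendsto (fun d : ℝ => d⁻¹ • ∫ r in (t - d)..t, S.op r x) (𝓝[>] 0) (𝓝 (S.op t x)) := by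
  have h1 : Tendsto (fun d : ℝ => -d) (𝓝[>] 0) (𝓝[<] 0) := by
    simpa using tendsto_neg_nhdsGT (a := (0 : ℝ))
  refine ((S.hasDerivAt_primitive x ht.le).tendsto_slope_zero_left.comp h1).congr' ?_
  filter_upwards [Ioo_mem_nhdsGT ht] with d hd
  rw [S.integral_op_eq_sub x (by linarith [hd.2]) ht.le, Function.comp_apply, inv_neg, neg_smul,
    ← smul_neg, neg_sub, ← sub_eq_add_neg]

theorem tendsto_intOp_generator {d : ℝ} (hd : 0 ≤ d) (x : X) :
    Tendsto (fun t : ℝ => ((t : ℂ)⁻¹) • (S.op t (S.intOp d x) - S.intOp d x)) (𝓝[>] 0)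
      (𝓝 (S.op d x - x)) := by
  have h0 := (S.hasDerivAt_primitive x le_rfl).tendsto_slope_zero_right
  rw [S.op_zero] at h0
  refine ((S.hasDerivAt_primitive x hd).tendsto_slope_zero_right.sub h0).congr' ?_
  filter_upwards [self_mem_nhdsWithin] with h hh
  have hh' : (0 : ℝ) ≤ h := le_of_lt hh
  rw [S.op_intOp hd hh', intOp, S.integral_op_eq_sub x hh' (by linarith),
    S.integral_op_eq_sub x le_rfl hd, ← Complex.ofReal_inv, Complex.coe_smul, ← smul_sub, zero_add]
  congr 1
  abel

/-- Since A ∫₀ᵈ S(r)x dr = S(d)x - x, the integrated orbit lies in the range of R_μ. This formula is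
what extends the integral operator to V. -/
theorem resolvent_intOp {μ : ℂ} (hμ : μ ∉ S.spectrum) {d : ℝ} (hd : 0 ≤ d) (x : X) :
    S.resolvent hμ (μ • S.intOp d x - (S.op d x - x)) = S.intOp d x := by
  have hmem : S.intOp d x ∈ S.generator.domain := ⟨_, S.tendsto_intOp_generator hd x⟩
  have hgen : S.generator ⟨_, hmem⟩ = S.op d x - x :=
    tendsto_nhds_unique (S.generator_spec ⟨_, hmem⟩) (S.tendsto_intOp_generator hd x)
  have := (S.resolvent_spec hμ).2 ⟨_, hmem⟩
  rwa [hgen] at this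

/-- The bounded operator `x ↦ ∫₀ᵈ S(r) x dr`, `d ≥ 0`. -/
theorem exists_intOp_clm {d : ℝ} (hd : 0 ≤ d) :
    ∃ J : X →L[ℂ] X, ∀ x, J x = S.intOp d x := by
  obtain ⟨C, hC0, hC⟩ := S.exists_norm_op_le d
  refine ⟨LinearMap.mkContinuous
    { toFun := S.intOp d
      map_add' := fun x y => ?_
      map_smul' := fun c x => ?_ } (C * |d - 0|) fun x => ?_, fun x => rfl⟩
  · simp only [intOp, map_add]
    exact intervalIntegral.integral_add (S.intervalIntegrable_op x le_rfl hd)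
      (S.intervalIntegrable_op y le_rfl hd)
  · simp only [intOp, map_smul, RingHom.id_apply]
    exact intervalIntegral.integral_smul _ _
  · have : ‖∫ r in (0 : ℝ)..d, S.op r x‖ ≤ (C * ‖x‖) * |d - 0| := by
      refine intervalIntegral.norm_integral_le_of_norm_le_const fun r hr => ?_
      rw [Set.uIoc_of_le hd] at hr
      exact (ContinuousLinearMap.le_opNorm _ _).trans
        (mul_le_mul_of_nonneg_right (hC r ⟨hr.1.le, hr.2⟩) (norm_nonneg _))
    refine this.trans (le_of_eq (by ring))

end Basic

end C0Semigroup

/-! ### The semigroup on generalized eigenspaces. -/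

namespace C0Semigroup

section GeneralizedEigenvectors

variable {X : Type*} [NormedAddCommGroup X] [NormedSpace ℂ X] (S : C0Semigroup X)

theorem mem_genKer_succ {l : ℂ} {n : ℕ} {x : X} :
    x ∈ S.genKer l (n + 1) ↔
      ∃ h : x ∈ S.generator.domain, S.generator ⟨x, h⟩ - l • x ∈ S.genKer l n := by
  constructor
  · rintro ⟨y, hy, rfl⟩
    exact ⟨y.2, hy⟩
  · rintro ⟨h, hx⟩
    exact ⟨⟨x, h⟩, hx, rfl⟩

theorem genKer_mono (l : ℂ) : Monotone (S.genKer l) := by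
  refine monotone_nat_of_le_succ fun n => ?_
  induction n with
  | zero => exact bot_le
  | succ n ih =>
    intro x hx
    obtain ⟨h, hx'⟩ := S.mem_genKer_succ.1 hx
    exact S.mem_genKer_succ.2 ⟨h, ih hx'⟩

theorem mem_genEigenspace {l : ℂ} {x : X} :
    x ∈ S.genEigenspace l ↔ ∃ n, x ∈ S.genKer l n :=
  Submodule.mem_iSup_of_directed _ (S.genKer_mono l).directed_le

theorem genEigenspace_generator {l : ℂ} {x : X} (hx : x ∈ S.genEigenspace l) :
    ∃ h : x ∈ S.generator.domain, S.generator ⟨x, h⟩ - l • x ∈ S.genEigenspace l := by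
  obtain ⟨n, hn⟩ := S.mem_genEigenspace.1 hx
  obtain ⟨h, hx'⟩ := S.mem_genKer_succ.1 (S.genKer_mono l n.le_succ hn)
  exact ⟨h, S.mem_genEigenspace.2 ⟨n, hx'⟩⟩

/-- The inclusion of the generalized eigenspace in the domain of the generator. -/
noncomputable def genEigenspaceInclusion (l : ℂ) : S.genEigenspace l →ₗ[ℂ] S.generator.domain :=
  Submodule.inclusion fun _ hx => (S.genEigenspace_generator hx).1

/-- The restriction of `A - λ I` to the generalized eigenspace at `λ`. -/
noncomputable def nilpotentPart (l : ℂ) : Module.End ℂ (S.genEigenspace l) :=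
  LinearMap.codRestrict _
    ((S.generator.toFun - l • S.generator.domain.subtype) ∘ₗ S.genEigenspaceInclusion l)
    fun x => (S.genEigenspace_generator x.2).2

theorem coe_nilpotentPart {l : ℂ} (x : S.genEigenspace l) :
    (S.nilpotentPart l x : X) =
      S.generator (S.genEigenspaceInclusion l x) - l • (x : X) := rfl

theorem nilpotentPart_pow_eq_zero {l : ℂ} {n : ℕ} :
    ∀ x : S.genEigenspace l, (x : X) ∈ S.genKer l n → (S.nilpotentPart l ^ n) x = 0 := by
  induction n with
  | zero =>
    intro x hx
    have : (x : X) = 0 := hx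
    simpa using this
  | succ n ih =>
    intro x hx
    rw [pow_succ, Module.End.mul_apply]
    exact ih _ (S.mem_genKer_succ.1 hx).2

/-- Each vector is killed by some power, and in finite dimension the kernels of powers stop growing
at the dimension. -/
theorem nilpotentPart_pow_multiplicity {l : ℂ} (hl : Module.Finite ℂ (S.genEigenspace l)) :
    S.nilpotentPart l ^ S.multiplicity l = 0 := by
  refine LinearMap.ext fun x => ?_
  obtain ⟨n, hn⟩ := S.mem_genEigenspace.1 x.2
  exact Module.End.ker_pow_le_ker_pow_finrank _ n (S.nilpotentPart_pow_eq_zero x hn)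

theorem hasDerivWithinAt_exp_smul_op (l : ℂ) (x : S.generator.domain) {t : ℝ} (ht : 0 ≤ t) :
    HasDerivWithinAt (fun s : ℝ => Complex.exp (-l * s) • S.op s (x : X))
      (Complex.exp (-l * t) • S.op t (S.generator x - l • (x : X))) (Set.Ici t) t := by
  have h1 : HasDerivAt (fun s : ℝ => Complex.exp (-l * s)) (Complex.exp (-l * t) * (-l)) t := by
    have := ((hasDerivAt_id (t : ℂ)).const_mul (-l)).cexp.comp_ofReal
    simpa using this
  refine (h1.hasDerivWithinAt.smul (S.hasDerivWithinAt_op x ht)).congr_deriv ?_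
  rw [map_sub, map_smul, smul_sub, mul_smul, neg_smul, smul_neg]
  abel

variable [CompleteSpace X]

theorem continuousOn_exp_smul_op (l : ℂ) (x : X) :
    ContinuousOn (fun s : ℝ => Complex.exp (-l * s) • S.op s x) (Set.Ici 0) :=
  (by fun_prop : Continuous fun s : ℝ => Complex.exp (-l * s)).continuousOn.smul
    (S.continuousOn_op x)

/-- The action of the semigroup on generalized eigenvectors, expanded around any time `a ≥ 0`. -/
theorem exp_smul_op_eq_sum {l : ℂ} {n : ℕ} : ∀ x : S.genEigenspace l,
    (S.nilpotentPart l ^ n) x = 0 → ∀ {a t : ℝ}, 0 ≤ a → 0 ≤ t →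
    Complex.exp (-l * t) • S.op t (x : X) = ∑ k ∈ Finset.range n,
      (((t : ℂ) - a) ^ k / (k.factorial : ℂ)) • Complex.exp (-l * a) •
        S.op a (((S.nilpotentPart l ^ k) x : S.genEigenspace l) : X) := by
  induction n with
  | zero =>
    intro x hx a t _ _
    have : x = 0 := by simpa using hx
    simp [this]
  | succ n ih =>
    intro x hx a t ha ht
    rw [pow_succ, Module.End.mul_apply] at hx
    set w : ℕ → X := fun k => Complex.exp (-l * a) •
        S.op a (((S.nilpotentPart l ^ k) x : S.genEigenspace l) : X) with hw
    -- The Taylor polynomial at a. Its derivative is the same polynomial for N x, which the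
    -- induction hypothesis identifies.
    set ρ : ℝ → X := fun s => ∑ k ∈ Finset.range (n + 1),
      (((s : ℂ) - a) ^ k / (k.factorial : ℂ)) • w k with hρ
    have hρd : ∀ s : ℝ, HasDerivAt ρ (∑ k ∈ Finset.range n,
        (((s : ℂ) - a) ^ k / (k.factorial : ℂ)) • w (k + 1)) s := by
      intro s
      have h1 : ∀ k : ℕ, HasDerivAt (fun r : ℝ => (((r : ℂ) - a) ^ k / (k.factorial : ℂ)))
          ((k : ℂ) * ((s : ℂ) - a) ^ (k - 1) / (k.factorial : ℂ)) s := by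
        intro k
        have := ((((hasDerivAt_id (s : ℂ)).sub_const (a : ℂ)).pow k).div_const
          (k.factorial : ℂ)).comp_ofReal
        simpa using this
      have h2 := HasDerivAt.fun_sum fun k (_ : k ∈ Finset.range (n + 1)) =>
        (h1 k).smul_const (w k)
      refine h2.congr_deriv ?_
      rw [Finset.sum_range_succ']
      simp only [Nat.cast_zero, zero_mul, zero_div, zero_smul, add_zero]
      refine Finset.sum_congr rfl fun k _ => ?_
      congr 1
      have h3 : ((k : ℂ) + 1) ≠ 0 := by exact_mod_cast Nat.succ_ne_zero k
      have h4 : (k.factorial : ℂ) ≠ 0 := by exact_mod_cast k.factorial_ne_zero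
      rw [Nat.factorial_succ]
      push_cast
      field_simp
    have hconst := constant_of_has_deriv_right_zero
      (f := fun s : ℝ => Complex.exp (-l * s) • S.op s (x : X) - ρ s) (a := 0)
      (b := max a t + 1)
      (((S.continuousOn_exp_smul_op l x).mono fun s hs => hs.1).sub
        (continuous_iff_continuousAt.2 fun s => (hρd s).continuousAt).continuousOn)
      fun s hs => by
        refine ((S.hasDerivWithinAt_exp_smul_op l (S.genEigenspaceInclusion l x) hs.1).sub
          (hρd s).hasDerivWithinAt).congr_deriv ?_
        have := ih (S.nilpotentPart l x) hx ha hs.1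
        rw [S.coe_nilpotentPart] at this
        change Complex.exp (-l * s) • S.op s (S.generator (S.genEigenspaceInclusion l x) -
          l • (x : X)) - _ = 0
        rw [this, sub_eq_zero]
        refine Finset.sum_congr rfl fun k _ => ?_
        rw [hw]
        simp only
        rw [pow_succ, Module.End.mul_apply]
    have hat := (hconst t ⟨ht, by linarith [le_max_right a t]⟩).trans
      (hconst a ⟨ha, by linarith [le_max_left a t]⟩).symm
    -- At time a only the term k = 0 is nonzero, so the constant difference is 0.
    have hza : Complex.exp (-l * a) • S.op a (x : X) - ρ a = 0 := by
      rw [hρ, sub_eq_zero]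
      dsimp only
      rw [Finset.sum_range_succ', Finset.sum_eq_zero fun k _ => ?_]
      · simp [hw]
      · simp
    rw [hza] at hat
    exact sub_eq_zero.1 hat

theorem op_eq_sum {l : ℂ} {n : ℕ} (x : S.genEigenspace l)
    (hx : (S.nilpotentPart l ^ n) x = 0) {t : ℝ} (ht : 0 ≤ t) :
    S.op t (x : X) = ((∑ k ∈ Finset.range n, (Complex.exp (l * t) * ((t : ℂ) ^ k /
      (k.factorial : ℂ))) • (S.nilpotentPart l ^ k) x : S.genEigenspace l) : X) := by
  have h := congrArg (fun z => Complex.exp (l * t) • z) (S.exp_smul_op_eq_sum x hx le_rfl ht)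
  simp only [smul_smul, ← Complex.exp_add] at h
  simp only [neg_mul, add_neg_cancel, Complex.exp_zero, one_smul, Complex.ofReal_zero, mul_zero,
    mul_one, sub_zero, S.op_zero, ContinuousLinearMap.id_apply] at h
  rw [h, Finset.smul_sum]
  simp [smul_smul]

theorem op_mem_genEigenspace {l : ℂ} {x : X} (hx : x ∈ S.genEigenspace l) {t : ℝ} (ht : 0 ≤ t) :
    S.op t x ∈ S.genEigenspace l := by
  obtain ⟨n, hn⟩ := S.mem_genEigenspace.1 hx
  rw [S.op_eq_sum ⟨x, hx⟩ (S.nilpotentPart_pow_eq_zero ⟨x, hx⟩ hn) ht]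
  exact Subtype.prop _

/-- A functional on the generalized eigenspace annihilating the range of `A - λ I` is an
eigenvector of the adjoint semigroup. -/
theorem functional_op_eq {l : ℂ} (h : S.genEigenspace l →ₗ[ℂ] ℂ)
    (hN : ∀ x, h (S.nilpotentPart l x) = 0) (x : S.genEigenspace l) {t : ℝ} (ht : 0 ≤ t) :
    h ⟨S.op t x, S.op_mem_genEigenspace x.2 ht⟩ = Complex.exp (l * t) * h x := by
  obtain ⟨n, hn⟩ := S.mem_genEigenspace.1 x.2
  have hn' := S.nilpotentPart_pow_eq_zero x (S.genKer_mono l n.le_succ hn)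
  have e : (⟨S.op t x, S.op_mem_genEigenspace x.2 ht⟩ : S.genEigenspace l) = _ :=
    Subtype.ext (S.op_eq_sum x hn' ht)
  -- All terms with k ≥ 1 lie in the range of N, where h vanishes.
  rw [e, map_sum, Finset.sum_range_succ', Finset.sum_eq_zero fun k _ => ?_]
  · simp
  · rw [map_smul, pow_succ' (S.nilpotentPart l), Module.End.mul_apply, hN, smul_zero]

theorem functional_nilpotentPart_pow_op {l : ℂ} (h : S.genEigenspace l →ₗ[ℂ] ℂ) {j : ℕ}
    (hN : ∀ x, h ((S.nilpotentPart l ^ (j + 1)) x) = 0) (x : S.genEigenspace l) {t : ℝ}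
    (ht : 0 ≤ t) :
    h ((S.nilpotentPart l ^ j) ⟨S.op t x, S.op_mem_genEigenspace x.2 ht⟩) =
      Complex.exp (l * t) * h ((S.nilpotentPart l ^ j) x) :=
  S.functional_op_eq (h ∘ₗ (S.nilpotentPart l ^ j)) (fun y => by
    have := hN y
    rwa [pow_succ, Module.End.mul_apply] at this) x ht

/-- Expansion of `S(ν - τ) x` in the functions `(-τ)ᵏ exp (-λ τ)`. -/
theorem op_sub_eq_sum {l : ℂ} {n : ℕ} (x : S.genEigenspace l)
    (hx : (S.nilpotentPart l ^ n) x = 0) {ν τ : ℝ} (hτ : τ ∈ Set.Icc 0 ν) :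
    S.op (ν - τ) (x : X) = ∑ k ∈ Finset.range n,
      ((-(τ : ℂ)) ^ k * Complex.exp (-l * τ) / (k.factorial : ℂ)) •
        S.op ν (((S.nilpotentPart l ^ k) x : S.genEigenspace l) : X) := by
  -- Base point ν and time ν - τ: the increment is -τ, which produces exactly the functions of
  -- `expFamily`.
  have h := congrArg (fun z => Complex.exp (l * (ν - τ)) • z)
    (S.exp_smul_op_eq_sum x hx (a := ν) (t := ν - τ) (hτ.1.trans hτ.2) (sub_nonneg.2 hτ.2))
  simp only [Finset.smul_sum, smul_smul, ← Complex.exp_add] at h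
  have e1 : l * (ν - τ) + -l * ((ν - τ : ℝ) : ℂ) = 0 := by push_cast; ring
  rw [e1, Complex.exp_zero, one_smul] at h
  rw [h]
  refine Finset.sum_congr rfl fun k _ => ?_
  congr 1
  have e2 : -l * (τ : ℂ) = l * (ν - τ) + -l * ν := by ring
  have e3 : ((ν - τ : ℝ) : ℂ) - ν = -τ := by push_cast; ring
  rw [e2, Complex.exp_add, e3]
  ring

end GeneralizedEigenvectors

end C0Semigroup

/-! ### The extrapolation space V and the smoothing operator from V to X. -/

namespace C0Semigroup

section ExtrapolationSpace

variable {X : Type*} [NormedAddCommGroup X] [NormedSpace ℂ X]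
  (S : C0Semigroup X) {μ : ℂ} (hμ : μ ∉ S.spectrum)
  {U : Type*} [NormedAddCommGroup U] [NormedSpace ℂ U]

/-- The embedding of `X` in the extrapolation space as a bounded operator. -/
noncomputable def embedL : X →L[ℂ] S.Extrap hμ :=
  (S.embed hμ).mkContinuous ‖S.resolvent hμ‖ fun x => by
    rw [norm_embed]
    exact (S.resolvent hμ).le_opNorm x

theorem embedL_apply (x : X) : S.embedL hμ x = S.embed hμ x := rfl

theorem inputIntegral_indicatorConstLp (B : U →L[ℂ] S.Extrap hμ) {t a b : ℝ} (ha : 0 ≤ a)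
    (hb : b ≤ t) (w : U) :
    S.inputIntegral hμ B t (indicatorConstLp 2 (measurableSet_Icc (a := a) (b := b))
      (measure_ne_top _ _) w) = ∫ τ in Set.Icc a b, S.extOp hμ (t - τ) (B w) := by
  have h1 : S.inputIntegral hμ B t (indicatorConstLp 2 (measurableSet_Icc (a := a) (b := b))
      (measure_ne_top _ _) w) = ∫ τ in Set.Icc 0 t,
        (Set.Icc a b).indicator (fun τ => S.extOp hμ (t - τ) (B w)) τ := by
    refine integral_congr_ae ?_
    filter_upwards [indicatorConstLp_coeFn (p := 2) (μ := volume.restrict (Set.Icc 0 t))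
      (hs := measurableSet_Icc (a := a) (b := b)) (hμs := measure_ne_top _ _) (c := w)] with τ hτ
    rw [hτ]
    by_cases h : τ ∈ Set.Icc a b <;> simp [h]
  rw [h1, setIntegral_indicator measurableSet_Icc,
    Set.inter_eq_right.2 (Set.Icc_subset_Icc ha hb)]

variable [CompleteSpace X]

theorem intOp_comm {d : ℝ} (hd : 0 ≤ d) (K : X →L[ℂ] X)
    (hK : ∀ r, 0 ≤ r → ∀ x, K (S.op r x) = S.op r (K x)) (x : X) :
    K (S.intOp d x) = S.intOp d (K x) := by
  rw [intOp, ← ContinuousLinearMap.intervalIntegral_comp_comm _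
    (S.intervalIntegrable_op x le_rfl hd)]
  refine intervalIntegral.integral_congr fun r hr => ?_
  rw [Set.uIcc_of_le hd] at hr
  exact hK r hr.1 x

/-- True on X by definition of the norm, then by density. Being isometric, R_μ transports semigroup
laws and continuity from X to V. -/
theorem norm_extResolvent (v : S.Extrap hμ) : ‖S.extResolvent hμ v‖ = ‖v‖ := by
  refine (S.denseRange_embed hμ).induction_on v
    (isClosed_eq (by fun_prop) continuous_norm) fun x => ?_
  rw [extResolvent_embed, norm_embed]

theorem extResolvent_injective : Function.Injective (S.extResolvent hμ) :=
  (injective_iff_map_eq_zero _).2 fun v hv => by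
    rw [← norm_eq_zero, ← S.norm_extResolvent hμ, hv, norm_zero]

theorem embed_injective : Function.Injective (S.embed hμ) := fun x y h => by
  have := congrArg (S.extResolvent hμ) h
  rw [extResolvent_embed, extResolvent_embed] at this
  exact S.resolvent_injective hμ this

theorem extResolvent_extOp {t : ℝ} (ht : 0 ≤ t) (v : S.Extrap hμ) :
    S.extResolvent hμ (S.extOp hμ t v) = S.op t (S.extResolvent hμ v) := by
  refine (S.denseRange_embed hμ).induction_on v
    (isClosed_eq (by fun_prop) (by fun_prop)) fun x => ?_
  rw [S.extOp_embed hμ ht, extResolvent_embed, extResolvent_embed, S.resolvent_op hμ ht]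

theorem extOp_add_apply {s t : ℝ} (hs : 0 ≤ s) (ht : 0 ≤ t) (v : S.Extrap hμ) :
    S.extOp hμ (s + t) v = S.extOp hμ s (S.extOp hμ t v) := by
  apply S.extResolvent_injective hμ
  rw [S.extResolvent_extOp hμ (add_nonneg hs ht), S.extResolvent_extOp hμ hs,
    S.extResolvent_extOp hμ ht, S.op_add_apply hs ht]

theorem extOp_comm {s t : ℝ} (hs : 0 ≤ s) (ht : 0 ≤ t) (v : S.Extrap hμ) :
    S.extOp hμ s (S.extOp hμ t v) = S.extOp hμ t (S.extOp hμ s v) := by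
  rw [← S.extOp_add_apply hμ hs ht, ← S.extOp_add_apply hμ ht hs, add_comm]

theorem norm_extOp_apply_le {t : ℝ} (ht : 0 ≤ t) (v : S.Extrap hμ) :
    ‖S.extOp hμ t v‖ ≤ ‖S.op t‖ * ‖v‖ := by
  rw [← S.norm_extResolvent hμ, S.extResolvent_extOp hμ ht, ← S.norm_extResolvent hμ v]
  exact (S.op t).le_opNorm _

theorem continuousOn_extOp (v : S.Extrap hμ) :
    ContinuousOn (fun t : ℝ => S.extOp hμ t v) (Set.Ici 0) := by
  have hiso : Isometry (S.extResolvent hμ) :=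
    AddMonoidHomClass.isometry_of_norm _ (S.norm_extResolvent hμ)
  refine hiso.isUniformInducing.isInducing.continuousOn_iff.2 ?_
  exact (S.continuousOn_op (S.extResolvent hμ v)).congr fun t ht =>
    S.extResolvent_extOp hμ ht v

/-- The operator `v ↦ ∫₀ᵈ S(r) v dr` maps the extrapolation space boundedly into `X`. -/
theorem exists_intOp_extension {d : ℝ} (hd : 0 ≤ d) :
    ∃ J : S.Extrap hμ →L[ℂ] X,
      (∀ v, S.resolvent hμ (J v) = S.intOp d (S.extResolvent hμ v)) ∧
      ∀ x, J (S.embed hμ x) = S.intOp d x := by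
  obtain ⟨J, hJ⟩ := S.exists_intOp_clm hd
  have key : ∀ v, S.resolvent hμ ((((μ • J) - (S.op d - ContinuousLinearMap.id ℂ X)).comp
      (S.extResolvent hμ)) v) = S.intOp d (S.extResolvent hμ v) := fun v => by
    rw [← S.resolvent_intOp hμ hd (S.extResolvent hμ v)]
    simp [hJ]
  -- The witness is (μ ∫₀ᵈ S(r) dr - (S(d) - I)) ∘ R_μ, bounded on V because R_μ is.
  refine ⟨_, key, fun x => S.resolvent_injective hμ ?_⟩
  rw [key, extResolvent_embed]
  exact (S.intOp_comm hd (S.resolvent hμ) (fun r hr x => S.resolvent_op hμ hr x) x).symm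

/-- Averages of the orbit of `B w` are values of the input integral at indicator controls. -/
theorem embed_intOp_extension_extOp {d : ℝ} (hd : 0 ≤ d) {J : S.Extrap hμ →L[ℂ] X}
    (hJ : ∀ v, S.resolvent hμ (J v) = S.intOp d (S.extResolvent hμ v))
    (B : U →L[ℂ] S.Extrap hμ) {s t : ℝ} (hs : 0 ≤ s) (hst : s + d ≤ t) (w : U) :
    S.embed hμ (J (S.extOp hμ s (B w))) =
      S.inputIntegral hμ B t (indicatorConstLp 2
        (measurableSet_Icc (a := t - (s + d)) (b := t - s)) (measure_ne_top _ _) w) := by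
  rw [S.inputIntegral_indicatorConstLp hμ B (by linarith) (by linarith)]
  apply S.extResolvent_injective hμ
  have hcont : ContinuousOn (fun τ : ℝ => S.extOp hμ (t - τ) (B w))
      (Set.Icc (t - (s + d)) (t - s)) :=
    (S.continuousOn_extOp hμ (B w)).comp (by fun_prop) fun τ hτ => by
      simp only [Set.mem_Ici]
      linarith [hτ.2]
  rw [extResolvent_embed, hJ, S.extResolvent_extOp hμ hs,
    ← ContinuousLinearMap.integral_comp_comm _ hcont.integrableOn_Icc,
    ← S.intOp_comm hd (S.op s) (fun r hr x => S.op_comm hs hr x), S.op_intOp hd hs,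
    integral_Icc_eq_integral_Ioc, ← intervalIntegral.integral_of_le (by linarith)]
  have : (∫ τ in (t - (s + d))..(t - s), S.extResolvent hμ (S.extOp hμ (t - τ) (B w))) =
      ∫ τ in (t - (s + d))..(t - s), S.op (t - τ) (S.extResolvent hμ (B w)) := by
    refine intervalIntegral.integral_congr fun τ hτ => ?_
    rw [Set.uIcc_of_le (by linarith)] at hτ
    exact S.extResolvent_extOp hμ (by linarith [hτ.2]) _
  rw [this, intervalIntegral.integral_comp_sub_left (fun r => S.op r (S.extResolvent hμ (B w)))]
  congr 1 <;> ring

/-! ### Necessity of the range condition. -/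

/-- The set `Range {λ I - A, R_μ B}` is a subspace. -/
noncomputable def controlSubmodule (B : U →L[ℂ] S.Extrap hμ) (l : ℂ) : Submodule ℂ X :=
  LinearMap.range (l • S.generator.domain.subtype - S.generator.toFun) ⊔
    LinearMap.range ((S.extResolvent hμ).comp B : U →ₗ[ℂ] X)

theorem coe_controlSubmodule (B : U →L[ℂ] S.Extrap hμ) (l : ℂ) :
    (S.controlSubmodule hμ B l : Set X) = S.controlRange hμ B l := by
  ext z
  simp only [controlSubmodule, SetLike.mem_coe, Submodule.mem_sup, controlRange, Set.mem_ofPred_eq]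
  constructor
  · rintro ⟨_, ⟨x, rfl⟩, _, ⟨u, rfl⟩, rfl⟩
    exact ⟨x, u, rfl⟩
  · rintro ⟨x, u, rfl⟩
    exact ⟨_, ⟨x, rfl⟩, _, ⟨u, rfl⟩, rfl⟩

/-- Approximate null-controllability implies the density of `Range {λ I - A, R_μ B}`. -/
theorem ApproxNullControllable.closure_controlRange {B : U →L[ℂ] S.Extrap hμ} {t : ℝ}
    (ht : 0 ≤ t) (h : S.ApproxNullControllable hμ B t) {l : ℂ} (hl : l ∈ S.spectrum) :
    closure (S.controlRange hμ B l) = Set.univ := by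
  rw [← coe_controlSubmodule]
  by_contra hne
  obtain ⟨z, hz⟩ := (Set.ne_univ_iff_exists_notMem _).1 hne
  obtain ⟨g, hg, hgz⟩ := Submodule.exists_dual_of_notMem_closure _ hz
  refine hgz ?_
  have hgA : ∀ x : S.generator.domain, g (S.generator x - l • (x : X)) = 0 := fun x => by
    have := hg (l • (x : X) - S.generator x) (Submodule.mem_sup_left ⟨x, rfl⟩)
    rw [← neg_sub, map_neg, this, neg_zero]
  have hgB : ∀ u, g (S.extResolvent hμ (B u)) = 0 := fun u =>
    hg _ (Submodule.mem_sup_right ⟨u, rfl⟩)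
  have hres : ∀ x, g x = (μ - l) * g (S.resolvent hμ x) := fun x => by
    obtain ⟨hx, e⟩ := (S.resolvent_spec hμ).1 x
    have h0 := hgA ⟨_, hx⟩
    have h1 := congrArg g e
    simp only [map_sub, map_smul, smul_eq_mul] at h0 h1
    linear_combination -h0 - h1
  have hμl : μ - l ≠ 0 := sub_ne_zero.2 fun e => hμ (e ▸ hl)
  -- On D(A) the function exp(-lr) g(S(r)x) has zero right derivative; `hres` carries the identity
  -- from R_μ x ∈ D(A) to every x.
  have hop : ∀ x, ∀ s : ℝ, 0 ≤ s → g (S.op s x) = Complex.exp (l * s) * g x := by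
    have hdom : ∀ x : S.generator.domain, ∀ s : ℝ, 0 ≤ s →
        g (S.op s (x : X)) = Complex.exp (l * s) * g x := by
      intro x s hs
      have hc := constant_of_has_deriv_right_zero
        (f := fun r : ℝ => g (Complex.exp (-l * r) • S.op r (x : X))) (a := 0) (b := s)
        (g.continuous.comp_continuousOn
          ((S.continuousOn_exp_smul_op l x).mono fun r hr => hr.1))
        (fun r hr => by
          have hd := (g.restrictScalars ℝ).hasFDerivAt.comp_hasDerivWithinAt r
            (S.hasDerivWithinAt_exp_smul_op l x hr.1)
          refine hd.congr_deriv ?_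
          obtain ⟨hr1, hr2⟩ := S.generator_op hr.1 x
          have := hgA ⟨_, hr1⟩
          rw [hr2] at this
          simp only [ContinuousLinearMap.coe_restrictScalars', map_smul, map_sub] at this ⊢
          rw [this, smul_zero]) s ⟨hs, le_rfl⟩
      simp only [map_smul, smul_eq_mul, Complex.ofReal_zero, mul_zero, Complex.exp_zero, one_mul,
        S.op_zero, ContinuousLinearMap.id_apply] at hc
      rw [← hc, ← mul_assoc, ← Complex.exp_add]
      simp
    intro x s hs
    have h1 := hdom ⟨_, ((S.resolvent_spec hμ).1 x).choose⟩ s hs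
    rw [hres (S.op s x), hres x, S.resolvent_op hμ hs, h1]
    ring
  set G : StrongDual ℂ (S.Extrap hμ) := g.comp (S.extResolvent hμ) with hG
  have hGop : ∀ v, ∀ s : ℝ, 0 ≤ s → G (S.extOp hμ s v) = Complex.exp (l * s) * G v :=
    fun v s hs => by
      rw [hG, ContinuousLinearMap.comp_apply, S.extResolvent_extOp hμ hs, hop _ s hs,
        ContinuousLinearMap.comp_apply]
  have hGint : ∀ u, G (S.inputIntegral hμ B t u) = 0 := fun u => by
    rw [inputIntegral]
    -- A non-integrable integrand has Bochner integral 0 by convention, so the conclusion holds in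
    -- that case too.
    by_cases hi : Integrable (fun τ => S.extOp hμ (t - τ) (B (u τ)))
        (volume.restrict (Set.Icc 0 t))
    · rw [← ContinuousLinearMap.integral_comp_comm _ hi]
      refine setIntegral_eq_zero_of_forall_eq_zero fun τ hτ => ?_
      rw [hGop _ _ (sub_nonneg.2 hτ.2), hG, ContinuousLinearMap.comp_apply, hgB, mul_zero]
    · rw [integral_undef hi, map_zero]
  rw [hres]
  refine mul_eq_zero_of_right _ ?_
  have hsmall : ∀ ε : ℝ, 0 < ε → ‖Complex.exp (l * t) * G (S.embed hμ z)‖ ≤ ‖G.comp (S.embedL hμ)‖ * ε := by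
    intro ε hε
    obtain ⟨u, x, hx, hxε⟩ := h z ε hε
    have := congrArg G hx
    rw [map_add, hGint, add_zero, ← S.extOp_embed hμ ht, hGop _ _ ht] at this
    rw [← this]
    exact ((G.comp (S.embedL hμ)).le_opNorm x).trans
      (mul_le_mul_of_nonneg_left hxε.le (norm_nonneg _))
  have hlim : Tendsto (fun ε : ℝ => ‖G.comp (S.embedL hμ)‖ * ε) (𝓝[>] 0) (𝓝 0) := by
    have : Continuous fun ε : ℝ => ‖G.comp (S.embedL hμ)‖ * ε := by fun_prop
    simpa using (this.tendsto 0).mono_left nhdsWithin_le_nhds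
  have hle := ge_of_tendsto hlim (b := ‖Complex.exp (l * t) * G (S.embed hμ z)‖) (by
    filter_upwards [self_mem_nhdsWithin] with ε hε
    exact hsmall ε hε)
  have h0 := norm_eq_zero.1 (le_antisymm hle (norm_nonneg _))
  rw [hG, ContinuousLinearMap.comp_apply, extResolvent_embed] at h0
  exact (mul_eq_zero.1 h0).resolve_left (Complex.exp_ne_zero _)

end ExtrapolationSpace

end C0Semigroup

/-! ### Expansions in generalized eigenvectors, tested against functionals. -/

namespace C0Semigroup

section Expansions

variable {X : Type*} [NormedAddCommGroup X] [NormedSpace ℂ X]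
  (S : C0Semigroup X) {μ : ℂ} (hμ : μ ∉ S.spectrum)

/-- `z` is the sum of a grouped series of generalized eigenvectors with components `d l`. -/
structure HasExpansion (z : S.Extrap hμ) (F : ℕ → Finset ℂ) (d : ℂ → X) : Prop where
  mono : Monotone F
  subset : ∀ m, (F m : Set ℂ) ⊆ S.spectrum
  exhaust : ∀ l ∈ S.spectrum, ∃ m, l ∈ F m
  mem : ∀ l ∈ S.spectrum, d l ∈ S.genEigenspace l
  tendsto : Tendsto (fun m => ∑ l ∈ F m, S.embed hμ (d l)) atTop (𝓝 z)

variable {S hμ}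

theorem PropertyIII.exists_hasExpansion {T : ℝ} (h : S.PropertyIII hμ T) {t : ℝ} (ht : T < t)
    (v : S.Extrap hμ) : ∃ F d, S.HasExpansion hμ (S.extOp hμ t v) F d := by
  obtain ⟨F, c, h1, h2, h3, h4, h5⟩ := h v
  exact ⟨F, fun l => c l t, h1, h2, h3, fun l hl => h4 l hl t ht,
    (h5 t t ht).tendsto_at ⟨le_rfl, le_rfl⟩⟩

theorem HasExpansion.functional_eq_zero {z : S.Extrap hμ} {F : ℕ → Finset ℂ} {d : ℂ → X}
    (h : S.HasExpansion hμ z F d) (G : StrongDual ℂ (S.Extrap hμ))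
    (hG : ∀ l ∈ S.spectrum, ∀ x ∈ S.genEigenspace l, G (S.embed hμ x) = 0) : G z = 0 := by
  refine tendsto_nhds_unique ((G.continuous.tendsto z).comp h.tendsto)
    (tendsto_const_nhds.congr fun m => ?_)
  rw [Function.comp_apply, map_sum, Finset.sum_eq_zero]
  exact fun l hl => hG l (h.subset m hl) _ (h.mem l (h.subset m hl))

/-- Once the group containing l has entered, G of the partial sums is constant. -/
theorem HasExpansion.functional_eq {z : S.Extrap hμ} {F : ℕ → Finset ℂ} {d : ℂ → X}
    (h : S.HasExpansion hμ z F d) (G : StrongDual ℂ (S.Extrap hμ)) {l : ℂ} (hl : l ∈ S.spectrum)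
    (hG : ∀ l' ∈ S.spectrum, l' ≠ l → ∀ x ∈ S.genEigenspace l', G (S.embed hμ x) = 0) :
    G z = G (S.embed hμ (d l)) := by
  refine tendsto_nhds_unique ((G.continuous.tendsto z).comp h.tendsto)
    (tendsto_const_nhds.congr' ?_)
  obtain ⟨m₀, hm₀⟩ := h.exhaust l hl
  filter_upwards [eventually_ge_atTop m₀] with m hm
  rw [Function.comp_apply, map_sum, Finset.sum_eq_single l]
  · exact fun l' hl' hne => hG l' (h.subset m hl') hne _ (h.mem l' (h.subset m hl'))
  · exact fun hn => absurd (h.mono hm hm₀) hn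

end Expansions

/-! ### Functionals built from the biorthogonal family, and eigenfunctionals. -/

section Biorthogonal

variable {X : Type*} [NormedAddCommGroup X] [NormedSpace ℂ X] [CompleteSpace X]
  (S : C0Semigroup X) {μ : ℂ} (hμ : μ ∉ S.spectrum)

/-- The functional `w ↦ ∫₀^ν y(τ) G(S(ν - τ) w) dτ` on the extrapolation space. -/
theorem exists_weighted_functional {ν : ℝ} {y : ℝ → ℂ}
    (hy : MemLp y 2 (volume.restrict (Set.Icc 0 ν))) (G : StrongDual ℂ (S.Extrap hμ)) :
    ∃ M : StrongDual ℂ (S.Extrap hμ),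
      ∀ w, M w = ∫ τ in Set.Icc 0 ν, G (S.extOp hμ (ν - τ) w) * y τ := by
  obtain ⟨C, hC0, hC⟩ := S.exists_norm_op_le ν
  have hy1 : Integrable y (volume.restrict (Set.Icc 0 ν)) := hy.integrable one_le_two
  have hbound : ∀ w, ∀ τ ∈ Set.Icc 0 ν, ‖G (S.extOp hμ (ν - τ) w)‖ ≤ ‖G‖ * (C * ‖w‖) := by
    intro w τ hτ
    refine (G.le_opNorm _).trans (mul_le_mul_of_nonneg_left ?_ (norm_nonneg _))
    exact (S.norm_extOp_apply_le hμ (sub_nonneg.2 hτ.2) w).trans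
      (mul_le_mul_of_nonneg_right (hC _ ⟨sub_nonneg.2 hτ.2, by linarith [hτ.1]⟩) (norm_nonneg _))
  have hcont : ∀ w, ContinuousOn (fun τ : ℝ => G (S.extOp hμ (ν - τ) w)) (Set.Icc 0 ν) :=
    fun w => G.continuous.comp_continuousOn
      ((S.continuousOn_extOp hμ w).comp (by fun_prop) fun τ hτ => sub_nonneg.2 hτ.2)
  have hint : ∀ w, Integrable (fun τ : ℝ => G (S.extOp hμ (ν - τ) w) * y τ)
      (volume.restrict (Set.Icc 0 ν)) := fun w =>
    hy1.bdd_mul ((hcont w).aestronglyMeasurable measurableSet_Icc)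
      ((ae_restrict_iff' measurableSet_Icc).2 (Eventually.of_forall (hbound w)))
  refine ⟨LinearMap.mkContinuous
    { toFun := fun w => ∫ τ in Set.Icc 0 ν, G (S.extOp hμ (ν - τ) w) * y τ
      map_add' := fun v w => ?_
      map_smul' := fun c w => ?_ }
    (‖G‖ * C * ∫ τ in Set.Icc 0 ν, ‖y τ‖) fun w => ?_, fun w => rfl⟩
  · simp only [map_add, add_mul]
    exact integral_add (hint v) (hint w)
  · simp only [map_smul, smul_eq_mul, mul_assoc, RingHom.id_apply]
    exact integral_const_mul _ _
  · have h1 : ‖∫ τ in Set.Icc 0 ν, G (S.extOp hμ (ν - τ) w) * y τ‖ ≤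
        ∫ τ in Set.Icc 0 ν, ‖G‖ * (C * ‖w‖) * ‖y τ‖ := by
      refine norm_integral_le_of_norm_le (hy1.norm.const_mul _) ?_
      refine (ae_restrict_iff' measurableSet_Icc).2 (Eventually.of_forall fun τ hτ => ?_)
      rw [norm_mul]
      exact mul_le_mul_of_nonneg_right (hbound w τ hτ) (norm_nonneg _)
    rw [integral_const_mul] at h1
    exact h1.trans (le_of_eq (by ring))

variable {S} in
-- With y taken from the biorthogonal family, at most one term of this sum survives.
theorem weighted_integral_genEigenspace {l : ℂ} (hl : l ∈ S.spectrum)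
    (hfin : Module.Finite ℂ (S.genEigenspace l)) {ν : ℝ} {y : ℝ → ℂ}
    (hy : MemLp y 2 (volume.restrict (Set.Icc 0 ν))) (G : StrongDual ℂ (S.Extrap hμ))
    (x : S.genEigenspace l) :
    ∫ τ in Set.Icc 0 ν, G (S.extOp hμ (ν - τ) (S.embed hμ x)) * y τ =
      ∑ k : Fin (S.multiplicity l),
        (G (S.embed hμ (S.op ν (((S.nilpotentPart l ^ (k : ℕ)) x : S.genEigenspace l) : X))) /
          ((k : ℕ).factorial : ℂ)) * ∫ τ in Set.Icc 0 ν, S.expFamily ⟨⟨l, hl⟩, k⟩ τ * y τ := by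
  have hx : (S.nilpotentPart l ^ S.multiplicity l) x = 0 := by
    rw [S.nilpotentPart_pow_multiplicity hfin, LinearMap.zero_apply]
  have hint : ∀ k : Fin (S.multiplicity l),
      Integrable (fun τ : ℝ => S.expFamily ⟨⟨l, hl⟩, k⟩ τ * y τ)
        (volume.restrict (Set.Icc 0 ν)) := by
    intro k
    have hc : Continuous (S.expFamily ⟨⟨l, hl⟩, k⟩) := by
      unfold expFamily
      fun_prop
    obtain ⟨C, hC⟩ := (isCompact_Icc (a := (0 : ℝ)) (b := ν)).exists_bound_of_continuousOn
      hc.continuousOn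
    exact (hy.integrable one_le_two).bdd_mul hc.aestronglyMeasurable
      ((ae_restrict_iff' measurableSet_Icc).2 (Eventually.of_forall hC))
  simp only [← integral_const_mul]
  rw [← integral_finsetSum _ fun k _ => (hint k).const_mul _]
  refine setIntegral_congr_fun measurableSet_Icc fun τ hτ => ?_
  rw [S.extOp_embed hμ (sub_nonneg.2 hτ.2), S.op_sub_eq_sum x hx hτ, map_sum, map_sum,
    Finset.sum_mul, Finset.sum_range]
  refine Finset.sum_congr rfl fun k _ => ?_
  rw [map_smul, map_smul, smul_eq_mul, expFamily]
  ring

/-- A functional on the extrapolation space that is an eigenvector of the adjoint semigroup and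
annihilates the range of `B` vanishes if `Range {λ I - A, R_μ B}` is dense. -/
theorem eigenfunctional_eq_zero {U : Type*} [NormedAddCommGroup U] [NormedSpace ℂ U]
    {B : U →L[ℂ] S.Extrap hμ} {l : ℂ} (hrange : closure (S.controlRange hμ B l) = Set.univ)
    (G : StrongDual ℂ (S.Extrap hμ))
    (hop : ∀ t, 0 ≤ t → ∀ v, G (S.extOp hμ t v) = Complex.exp (l * t) * G v)
    (hB : ∀ u, G (B u) = 0) (v : S.Extrap hμ) : G v = 0 := by
  -- Differentiating the eigenrelation at t = 0.
  have hA : ∀ x : S.generator.domain, G (S.embed hμ (S.generator x)) = l * G (S.embed hμ x) := by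
    intro x
    have h1 : Tendsto (fun t : ℝ => G.comp (S.embedL hμ) (((t : ℂ)⁻¹) • (S.op t (x : X) - x)))
        (𝓝[>] 0) (𝓝 (G (S.embed hμ (S.generator x)))) :=
      ((G.comp (S.embedL hμ)).continuous.tendsto _).comp (S.generator_spec x)
    have h2 : HasDerivAt (fun s : ℝ => Complex.exp (l * s) * G (S.embed hμ x))
        (l * G (S.embed hμ x)) 0 := by
      have := (((hasDerivAt_id ((0 : ℝ) : ℂ)).const_mul l).cexp.comp_ofReal).mul_const
        (G (S.embed hμ x))
      simpa using this
    refine tendsto_nhds_unique h1 (h2.tendsto_slope_zero_right.congr' ?_)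
    filter_upwards [self_mem_nhdsWithin] with t ht
    have ht' : (0 : ℝ) ≤ t := le_of_lt ht
    rw [zero_add, ← hop t ht', S.extOp_embed hμ ht', ← Complex.coe_smul, Complex.ofReal_inv,
      map_smul, map_sub]
    simp [embedL_apply]
  have hres : ∀ w, G w = (μ - l) * G (S.embedL hμ (S.extResolvent hμ w)) := by
    intro w
    refine (S.denseRange_embed hμ).induction_on w
      (isClosed_eq (by fun_prop) (by fun_prop)) fun x => ?_
    obtain ⟨h, e⟩ := (S.resolvent_spec hμ).1 x
    have h0 := hA ⟨_, h⟩
    have h1 := congrArg (fun z => G (S.embed hμ z)) e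
    simp only [map_sub, map_smul, smul_eq_mul] at h1
    rw [extResolvent_embed, embedL_apply]
    simp only at h0
    linear_combination -h0 - h1
  have hker : ∀ x, (G.comp (S.embedL hμ)) x = 0 := by
    intro x
    have hx : x ∈ closure (S.controlRange hμ B l) := hrange ▸ Set.mem_univ x
    refine closure_minimal (t := {z | (G.comp (S.embedL hμ)) z = 0}) ?_
      (isClosed_eq (by fun_prop) continuous_const) hx
    rintro _ ⟨z, u, rfl⟩
    have h1 := hres (B u)
    rw [hB] at h1
    have h2 : G (S.embedL hμ (S.extResolvent hμ (B u))) = 0 := by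
      -- If μ = l, then `hres` already gives G = 0.
      rcases mul_eq_zero.1 h1.symm with h | h
      · have hz : ∀ w, G w = 0 := fun w => by rw [hres w, h, zero_mul]
        exact hz _
      · exact h
    change G (S.embedL hμ _) = 0
    rw [map_add, map_add, h2, add_zero, embedL_apply, map_sub, map_sub, map_smul, map_smul, hA,
      smul_eq_mul, sub_self]
  refine (S.denseRange_embed hμ).induction_on v
    (isClosed_eq (by fun_prop) continuous_const) fun x => hker x

end Biorthogonal

/-! ### Sufficiency of the range condition. -/

section Controllability

variable {X : Type*} [NormedAddCommGroup X] [NormedSpace ℂ X] [CompleteSpace X]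
  {S : C0Semigroup X} {μ : ℂ} {hμ : μ ∉ S.spectrum}
  {U : Type*} [NormedAddCommGroup U] [NormedSpace ℂ U]

/-- A functional annihilating the orbits of the range of `B` on an interval of length `ν` vanishes
on the images under `S(ν)` of all generalized eigenvectors. -/
theorem functional_genEigenspace_eq_zero {B : U →L[ℂ] S.Extrap hμ}
    (hfin : ∀ l ∈ S.spectrum, Module.Finite ℂ (S.genEigenspace l)) {ν : ℝ}
    (hmin : IsMinimalOn S.expFamily ν) {s : ℝ} (hs : 0 ≤ s)
    (hexp : ∀ v, ∃ F d, S.HasExpansion hμ (S.extOp hμ s v) F d)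
    {l : ℂ} (hl : l ∈ S.spectrum) (hrange : closure (S.controlRange hμ B l) = Set.univ)
    (G : StrongDual ℂ (S.Extrap hμ))
    (hG : ∀ r ∈ Set.Icc s (s + ν), ∀ u, G (S.extOp hμ r (B u)) = 0)
    {x : X} (hx : x ∈ S.genEigenspace l) : G (S.embed hμ (S.op ν x)) = 0 := by
  obtain ⟨y, hy, hy1, hy0⟩ := hmin
  set H : S.genEigenspace l →ₗ[ℂ] ℂ :=
    (((G.comp (S.embedL hμ)).comp (S.op ν) : X →L[ℂ] ℂ) : X →ₗ[ℂ] ℂ) ∘ₗ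
      (S.genEigenspace l).subtype with hH
  have hHx : ∀ z : S.genEigenspace l, H z = G (S.embed hμ (S.op ν z)) := fun z => rfl
  by_contra hne
  have hex : ∃ j, ∀ z, H ((S.nilpotentPart l ^ j) z) = 0 :=
    ⟨S.multiplicity l, fun z => by simp [S.nilpotentPart_pow_multiplicity (hfin l hl)]⟩
  classical
  -- The least vanishing power is positive because H is nonzero at x. Its predecessor j is the last
  -- nonvanishing one; showing that H ∘ Nʲ vanishes as well contradicts minimality.
  obtain ⟨j, hj⟩ : ∃ j, Nat.find hex = j + 1 := by
    refine Nat.exists_eq_succ_of_ne_zero fun h0 => hne ?_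
    have := Nat.find_spec hex
    rw [h0] at this
    exact this ⟨x, hx⟩
  have hjN : ∀ z, H ((S.nilpotentPart l ^ (j + 1)) z) = 0 := hj ▸ Nat.find_spec hex
  have hjlt : j < S.multiplicity l := by
    have : Nat.find hex ≤ S.multiplicity l := Nat.find_min' hex fun z => by
      simp [S.nilpotentPart_pow_multiplicity (hfin l hl)]
    omega
  refine Nat.find_min hex (m := j) (by omega) fun z => ?_
  set p : Σ l : S.spectrum, Fin (S.multiplicity l) := ⟨⟨l, hl⟩, ⟨j, hjlt⟩⟩ with hp
  obtain ⟨M, hM⟩ := S.exists_weighted_functional hμ (hy p) G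
  have hMself : ∀ z : S.genEigenspace l, M (S.embed hμ z) =
      H ((S.nilpotentPart l ^ j) z) / (j.factorial : ℂ) := by
    intro z
    rw [hM, weighted_integral_genEigenspace hμ hl (hfin l hl) (hy p) G z,
      Finset.sum_eq_single ⟨j, hjlt⟩, hy1 p, mul_one, hHx]
    · intro k _ hk
      rw [hy0 _ p fun e => hk (by simpa [hp] using e), mul_zero]
    · simp
  have hMother : ∀ l' ∈ S.spectrum, l' ≠ l → ∀ z ∈ S.genEigenspace l',
      M (S.embed hμ z) = 0 := by
    intro l' hl' hne' z hz
    rw [hM, weighted_integral_genEigenspace hμ hl' (hfin l' hl') (hy p) G ⟨z, hz⟩]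
    refine Finset.sum_eq_zero fun k _ => ?_
    rw [hy0 _ p fun e => hne' (congrArg (fun q => (q.1 : ℂ)) e), mul_zero]
  have hMop : ∀ t, 0 ≤ t → ∀ z ∈ S.genEigenspace l,
      M (S.embed hμ (S.op t z)) = Complex.exp (l * t) * M (S.embed hμ z) := by
    intro t ht z hz
    have h1 := hMself ⟨S.op t z, S.op_mem_genEigenspace hz ht⟩
    have h2 := S.functional_nilpotentPart_pow_op H hjN ⟨z, hz⟩ ht
    have h3 := hMself ⟨z, hz⟩
    simp only at h1 h2 h3
    rw [h1, h2, h3, mul_div_assoc]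
  -- M is known only on generalized eigenvectors; composing with S(s) reaches every v through the
  -- expansion of S(s)v. B is killed since ν - τ + s stays in [s, s + ν].
  have hzero := S.eigenfunctional_eq_zero hμ hrange (M.comp (S.extOp hμ s))
    (fun t ht v => by
      obtain ⟨F, d, hd⟩ := hexp v
      rw [ContinuousLinearMap.comp_apply, ContinuousLinearMap.comp_apply, S.extOp_comm hμ hs ht,
        hd.functional_eq M hl hMother, ← hMop t ht _ (hd.mem l hl)]
      refine (hd.functional_eq (M.comp (S.extOp hμ t)) hl fun l' hl' hne' z hz => ?_).trans ?_
      · rw [ContinuousLinearMap.comp_apply, S.extOp_embed hμ ht]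
        exact hMother l' hl' hne' _ (S.op_mem_genEigenspace hz ht)
      · rw [ContinuousLinearMap.comp_apply, S.extOp_embed hμ ht])
    (fun u => by
      rw [ContinuousLinearMap.comp_apply, hM]
      refine setIntegral_eq_zero_of_forall_eq_zero fun τ hτ => ?_
      rw [← S.extOp_add_apply hμ (sub_nonneg.2 hτ.2) hs,
        hG _ ⟨by linarith [hτ.2], by linarith [hτ.1]⟩, zero_mul])
    (S.embed hμ z)
  rw [ContinuousLinearMap.comp_apply, S.extOp_embed hμ hs, hMop s hs _ z.2, hMself] at hzero
  have hfac : (j.factorial : ℂ) ≠ 0 := by exact_mod_cast j.factorial_ne_zero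
  exact (div_eq_zero_iff.1 ((mul_eq_zero.1 hzero).resolve_left (Complex.exp_ne_zero _))).resolve_right
    hfac

/-- Density of `Range {λ I - A, R_μ B}` for all `λ` in the spectrum implies approximate
null-controllability. -/
theorem approxNullControllable_of_closure_controlRange {B : U →L[ℂ] S.Extrap hμ}
    (hB : S.Admissible hμ B)
    (hfin : ∀ l ∈ S.spectrum, Module.Finite ℂ (S.genEigenspace l))
    {T : ℝ} (hT : 0 ≤ T) (hIII : S.PropertyIII hμ T) {ν : ℝ} (hν : 0 ≤ ν)
    (hmin : IsMinimalOn S.expFamily ν) {t : ℝ} (ht : T + ν < t)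
    (hrange : ∀ l ∈ S.spectrum, closure (S.controlRange hμ B l) = Set.univ) :
    S.ApproxNullControllable hμ B t := by
  have ht0 : 0 < t := by linarith
  obtain ⟨Φ, hΦ⟩ := hB t ht0.le
  intro x₀ ε hε
  -- It suffices to approximate S(t)x₀ by some Φ u and apply the control -u.
  by_cases hmem : S.op t x₀ ∈ closure (LinearMap.range Φ.toLinearMap : Set X)
  · obtain ⟨_, ⟨u, rfl⟩, hu⟩ := Metric.mem_closure_iff.1 hmem ε hε
    refine ⟨-u, S.op t x₀ + Φ (-u), ?_, ?_⟩
    · rw [IsWeakSolutionAt, map_add, hΦ]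
    · rw [dist_eq_norm] at hu
      rwa [map_neg, ← sub_eq_add_neg]
  · exfalso
    obtain ⟨g, hg, hgx⟩ := Submodule.exists_dual_of_notMem_closure _ hmem
    refine hgx ?_
    -- The bound on d is what makes s = t - d - ν exceed T.
    have key : ∀ d ∈ Set.Ioo 0 (t - (T + ν)), g (∫ r in (t - d)..t, S.op r x₀) = 0 := by
      intro d hd
      obtain ⟨J, hJ, hJx⟩ := S.exists_intOp_extension hμ hd.1.le
      set s := t - d - ν with hs
      have hsT : T < s := by linarith [hd.2]
      have hs0 : 0 ≤ s := by linarith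
      have hexp := fun v => hIII.exists_hasExpansion hsT v
      have hG : ∀ r ∈ Set.Icc s (s + ν), ∀ u, (g.comp J) (S.extOp hμ r (B u)) = 0 := by
        intro r hr u
        have h1 := S.embed_intOp_extension_extOp hμ hd.1.le hJ B (s := r) (t := t)
          (hs0.trans hr.1) (by linarith [hr.2]) u
        rw [← hΦ] at h1
        rw [ContinuousLinearMap.comp_apply, S.embed_injective hμ h1]
        exact hg _ ⟨_, rfl⟩
      obtain ⟨F, c, hc⟩ := hexp (S.embed hμ x₀)
      have h2 := hc.functional_eq_zero ((g.comp J).comp (S.extOp hμ ν)) fun l hl x hx => by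
        rw [ContinuousLinearMap.comp_apply, S.extOp_embed hμ hν]
        exact functional_genEigenspace_eq_zero hfin hmin hs0 hexp hl (hrange l hl) _ hG hx
      have htd : 0 ≤ t - d := by linarith [hd.2]
      rw [ContinuousLinearMap.comp_apply, ← S.extOp_add_apply hμ hν hs0,
        show ν + s = t - d by rw [hs]; ring, S.extOp_embed hμ htd, ContinuousLinearMap.comp_apply,
        hJx, ← S.intOp_comm hd.1.le (S.op (t - d)) (fun r hr x => S.op_comm htd hr x),
        S.op_intOp hd.1.le htd, add_sub_cancel] at h2
      exact h2
    -- The averages over [t - d, t] tend to S(t)x₀ as d → 0+, which removes the smoothing.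
    refine tendsto_nhds_unique ((g.continuous.tendsto _).comp (S.tendsto_average_op x₀ ht0))
      (tendsto_const_nhds.congr' ?_)
    filter_upwards [Ioo_mem_nhdsGT (show (0 : ℝ) < t - (T + ν) by linarith)] with d hd
    rw [Function.comp_apply, ← Complex.coe_smul, map_smul, key d hd, smul_zero]

end Controllability

end C0Semigroup

theorem theorem2 {X U : Type*} [NormedAddCommGroup X] [NormedSpace ℂ X] [CompleteSpace X]
    [NormedAddCommGroup U] [NormedSpace ℂ U] [CompleteSpace U]
    (S : C0Semigroup X) {μ : ℂ} (hμ : μ ∉ S.spectrum)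
    (B : U →L[ℂ] S.Extrap hμ) (hB : S.Admissible hμ B)
    (hI : S.PropertyI) (hII : S.PropertyII)
    (T : ℝ) (hT : 0 ≤ T) (hIII : S.PropertyIII hμ T)
    (ν : ℝ) (hν : 0 < ν) (hmin : C0Semigroup.IsMinimalOn S.expFamily ν)
    (t₁ : ℝ) (ht₁ : 0 ≤ t₁) :
    (S.ApproxNullControllable hμ B t₁ →
      ∀ l ∈ S.spectrum, closure (S.controlRange hμ B l) = Set.univ) ∧
    (T + ν < t₁ → (∀ l ∈ S.spectrum, closure (S.controlRange hμ B l) = Set.univ) →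
      S.ApproxNullControllable hμ B t₁) := by
  exact ⟨fun h l hl => h.closure_controlRange S hμ ht₁ hl, fun ht h =>
    C0Semigroup.approxNullControllable_of_closure_controlRange hB hII.2.1 hT hIII hν.le hmin ht h⟩
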